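/- A **category of operations** is a symmetric monoidal category $\mathcal{C}$ with unit object $I$, together with a distinguished class $\mathcal{C}_1$ of *normalized* morphisms, such that: 1. every morphism set $\mathcal{C}(X,Y)$ is a module over the semiring $\mathbb{R}_{\ge 0}$; 2. composition and the tensor product of morphisms are bilinear with respect to these module structures; 3. $\mathcal{C}_1$ is a symmetric monoidal subcategory of $\mathcal{C}$ containing all identity morphisms (that is, it contains the identities, associators, unitors and symmetries together with their inverses, and is closed under composition and tensor products); 4. $\mathcal{C}(I,I)=\mathbb{R}_{\ge 0}$, i.e. $r\mapsto r\cdot \mathrm{id}_I$ is a bijection $\mathbb{R}_{\ge 0}\to\mathcal{C}(I,I)$, and $\mathcal{C}_1(I,I)=\{\mathrm{id}_I\}$; 5. $I$ is terminal in $\mathcal{C}_1$: for every object $X$ there is exactly one normalized morphism $X\to I$. Let $G=(V,E)$, $E\subseteq V\times V$, be a finite directed acyclic graph, with a linear ordering on the set $\mathrm{in}(v)$ of incoming edges and on the set $\mathrm{out}(v)$ of outgoing edges of each node $v$, and let $(O_v)_{v\in V}$ be finite sets of outcomes. A family of numbers $P(o)\in\mathbb{R}_{\ge 0}$, indexed by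 the joint outcomes $o\in\prod_{v\in V}O_v$, is a **$\mathcal{C}$-correlation** on $G$ if there are objects $X_e$ of $\mathcal{C}$ for $e\in E$, and for each $v\in V$ a family of morphisms $$f_v(a)\colon \bigotimes_{e\in \mathrm{in}(v)}X_e\longrightarrow\bigotimes_{e\in \mathrm{out}(v)}X_e\qquad(a\in O_v)$$ such that $\sum_{a\in O_v}f_v(a)$ is normalized, and such that for every $o$ the value in $\mathcal{C}(I,I)$ of the string diagram $G$, with the edges labelled by the $X_e$ and each node $v$ labelled by $f_v(o_v)$, equals $P(o)\cdot \mathrm{id}_I$. Here the *value* is the one of the graphical calculus of symmetric monoidal categories: the diagram is cut into slices, each of which consists either of one node next to identity wires or of one crossing of two wires (a symmetry), and these slices are composed. **Proposition.** Let $\mathcal{C}$ and $\mathcal{D}$ be categories of operations. Let $F\colon\mathcal{C}\to\mathcal{D}$ be a (strong) symmetric monoidal functor which is linear (it preserves addition of morphisms and their multiplication by scalars in $\mathbb{R}_{\ge 0}$) and which restricts to a symmetric monoidal functor $\mathcal{C}_1\to\mathcal{D}_1$; that is, $F$ maps normalized morphisms to normalized morphisms, and its structure isomorphisms $I_{\mathcal{D}}\cong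 F(I_{\mathcal{C}})$ and $F(X)\otimes F(Y)\cong F(X\otimes Y)$ and their inverses are normalized (which is automatic if $F$ is strict monoidal). Then for every finite directed acyclic graph $G$, all linear orderings on the sets $\mathrm{in}(v)$ and $\mathrm{out}(v)$, and all finite outcome sets, every $\mathcal{C}$-correlation on $G$ is also a $\mathcal{D}$-correlation on $G$. -/

import Mathlib

open CategoryTheory MonoidalCategory
open scoped NNReal

universe v₁ v₂ u₁ u₂ w₁ w₂

/-! ### Categories of operations -/

/-- A symmetric monoidal category of operations.  The morphisms are the operations; the class
`normalized` of morphisms is a wide symmetric monoidal subcategory: `IsStableUnderBraiding` says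
that it contains the identities and the structure isomorphisms of `C` (associators, unitors,
braidings) and is closed under composition and tensor products. -/
class OperationCategory (C : Type u₁) [Category.{v₁} C] [MonoidalCategory C]
    [SymmetricCategory C] where
  /-- Morphisms can be added. -/
  homAddCommMonoid : ∀ X Y : C, AddCommMonoid (X ⟶ Y)
  /-- Every set of morphisms is a module over the semiring of nonnegative reals. -/
  homModule : ∀ X Y : C, Module ℝ≥0 (X ⟶ Y)
  add_comp : ∀ {X Y Z : C} (f f' : X ⟶ Y) (g : Y ⟶ Z), (f + f') ≫ g = f ≫ g + f' ≫ g
  comp_add : ∀ {X Y Z : C} (f : X ⟶ Y) (g g' : Y ⟶ Z), f ≫ (g + g') = f ≫ g + f ≫ g'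
  smul_comp : ∀ {X Y Z : C} (r : ℝ≥0) (f : X ⟶ Y) (g : Y ⟶ Z), (r • f) ≫ g = r • (f ≫ g)
  comp_smul : ∀ {X Y Z : C} (r : ℝ≥0) (f : X ⟶ Y) (g : Y ⟶ Z), f ≫ (r • g) = r • (f ≫ g)
  add_tensor : ∀ {X₁ Y₁ X₂ Y₂ : C} (f f' : X₁ ⟶ Y₁) (g : X₂ ⟶ Y₂),
    (f + f') ⊗ₘ g = (f ⊗ₘ g) + (f' ⊗ₘ g)
  tensor_add : ∀ {X₁ Y₁ X₂ Y₂ : C} (f : X₁ ⟶ Y₁) (g g' : X₂ ⟶ Y₂),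
    f ⊗ₘ (g + g') = (f ⊗ₘ g) + (f ⊗ₘ g')
  smul_tensor : ∀ {X₁ Y₁ X₂ Y₂ : C} (r : ℝ≥0) (f : X₁ ⟶ Y₁) (g : X₂ ⟶ Y₂),
    (r • f) ⊗ₘ g = r • (f ⊗ₘ g)
  tensor_smul : ∀ {X₁ Y₁ X₂ Y₂ : C} (r : ℝ≥0) (f : X₁ ⟶ Y₁) (g : X₂ ⟶ Y₂),
    f ⊗ₘ (r • g) = r • (f ⊗ₘ g)
  /-- The normalized operations. -/
  normalized : MorphismProperty C
  normalized_monoidal : normalized.IsStableUnderBraiding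
  /-- The endomorphisms of the unit are the nonnegative reals. -/
  unit_scalars : Function.Bijective fun r : ℝ≥0 => r • 𝟙 (𝟙_ C)
  /-- The only normalized endomorphism of the unit is the identity. -/
  normalized_unit : ∀ f : 𝟙_ C ⟶ 𝟙_ C, normalized f ↔ f = 𝟙 (𝟙_ C)
  /-- The unit is terminal among normalized operations: each system can be discarded in exactly
  one normalized way. -/
  normalized_discard : ∀ X : C, ∃! t : X ⟶ 𝟙_ C, normalized t

attribute [reducible] OperationCategory.homAddCommMonoid OperationCategory.homModule
attribute [instance] OperationCategory.homAddCommMonoid OperationCategory.homModule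

namespace OperationCategory

section Functors

variable {C : Type u₁} [Category.{v₁} C] [MonoidalCategory C] [SymmetricCategory C]
  [OperationCategory C]
  {D : Type u₂} [Category.{v₂} D] [MonoidalCategory D] [SymmetricCategory D]
  [OperationCategory D]

/-- The functor preserves addition and multiplication by nonnegative scalars. -/
structure IsLinearFunctor (F : C ⥤ D) : Prop where
  map_add : ∀ {X Y : C} (f g : X ⟶ Y), F.map (f + g) = F.map f + F.map g
  map_smul : ∀ {X Y : C} (r : ℝ≥0) (f : X ⟶ Y), F.map (r • f) = r • F.map f

/-- The monoidal functor `F` restricts to a monoidal functor between the subcategories of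
normalized operations: it sends normalized operations to normalized operations, and its structure
isomorphisms `𝟙_ ≅ F 𝟙_` and `F X ⊗ F Y ≅ F (X ⊗ Y)` are isomorphisms in the subcategory of
normalized operations (for a strict monoidal functor they are identities). -/
structure PreservesNormalized (F : C ⥤ D) [F.Monoidal] : Prop where
  map_mem : ∀ {X Y : C} (f : X ⟶ Y), normalized f → normalized (F.map f)
  ε_mem : normalized (Functor.LaxMonoidal.ε F)
  η_mem : normalized (Functor.OplaxMonoidal.η F)
  μ_mem : ∀ X Y : C, normalized (Functor.LaxMonoidal.μ F X Y)
  δ_mem : ∀ X Y : C, normalized (Functor.OplaxMonoidal.δ F X Y)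

end Functors

/-! ### Graphs -/

section Graphs

variable {V : Type w₁}

/-- No node is joined to itself by a directed path of positive length. -/
def IsAcyclic (G : Digraph V) : Prop := ∀ v : V, ¬ Relation.TransGen G.Adj v v

/-- The edges `v → w` of a directed graph, as pairs `(v, w)`. -/
abbrev Edge (G : Digraph V) : Type w₁ := {e : V × V // G.Adj e.1 e.2}

/-- A linear ordering of the set of incoming edges and of the set of outgoing edges of each node,
given as a list that contains each element of the set exactly once. -/
structure Polarization (G : Digraph V) where
  inc : V → List (Edge G)
  out : V → List (Edge G)
  inc_nodup : ∀ v, (inc v).Nodup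
  out_nodup : ∀ v, (out v).Nodup
  mem_inc : ∀ v e, e ∈ inc v ↔ e.1.2 = v
  mem_out : ∀ v e, e ∈ out v ↔ e.1.1 = v

end Graphs

/-! ### The value of a labelled graph -/

section Value

variable {C : Type u₁} [Category.{v₁} C] [MonoidalCategory C]

/-- The tensor product of a family of objects, in the order given by a list. -/
@[reducible] def tensorList {E : Type w₁} (X : E → C) : List E → C
  | [] => 𝟙_ C
  | e :: L => X e ⊗ tensorList X L

/-- The canonical isomorphism from the tensor product over a concatenated list. -/
def tensorListAppend {E : Type w₁} (X : E → C) (M : List E) :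
    ∀ L : List E, tensorList X (L ++ M) ≅ tensorList X L ⊗ tensorList X M
  | [] => (λ_ (tensorList X M)).symm
  | e :: L => whiskerLeftIso (X e) (tensorListAppend X M L) ≪≫
      (α_ (X e) (tensorList X L) (tensorList X M)).symm

/-- Apply `g` to the first factors. -/
def applyFirst {E : Type w₁} (X : E → C) (L L' M : List E)
    (g : tensorList X L ⟶ tensorList X L') :
    tensorList X (L ++ M) ⟶ tensorList X (L' ++ M) :=
  (tensorListAppend X M L).hom ≫ g ▷ tensorList X M ≫ (tensorListAppend X M L').inv

variable [SymmetricCategory C]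

/-- The symmetry exchanging two neighbouring factors. -/
def swapFirst {E : Type w₁} (X : E → C) (a b : E) (M : List E) :
    tensorList X (a :: b :: M) ⟶ tensorList X (b :: a :: M) :=
  (α_ (X a) (X b) (tensorList X M)).inv ≫ (β_ (X a) (X b)).hom ▷ tensorList X M ≫
    (α_ (X b) (X a) (tensorList X M)).hom

/-- The symmetry exchanging two neighbouring factors anywhere in a list. -/
def swapAt {E : Type w₁} (X : E → C) (a b : E) (M : List E) :
    ∀ L : List E, tensorList X (L ++ a :: b :: M) ⟶ tensorList X (L ++ b :: a :: M)
  | [] => swapFirst X a b M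
  | e :: L => X e ◁ swapAt X a b M L

variable {V : Type w₁} {G : Digraph V}

/-- Evaluation of the string diagram in `C` given by a graph whose edges `e` are labelled by
objects `X e` and whose nodes `v` are labelled by morphisms `g v`, from the bottom to the top, one
elementary slice at a time.  `Evaluates π X g S L m` says that `m` is the composite of slices in
which exactly the nodes in `S` have been used, once each, and such that the wires that leave the
top slice are the edges in `L`, in this order.  Each slice is either a crossing of two neighbouring
wires, or a node next to identity wires; a node can be used only when all its incoming edges are
present, in their linear ordering, and replaces them by its outgoing edges. -/
inductive Evaluates (π : Polarization G) (X : Edge G → C)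
    (g : ∀ v, tensorList X (π.inc v) ⟶ tensorList X (π.out v)) :
    Set V → (L : List (Edge G)) → (𝟙_ C ⟶ tensorList X L) → Prop
  | start : Evaluates π X g ∅ [] (𝟙 (𝟙_ C))
  | swap (S : Set V) (L : List (Edge G)) (a b : Edge G) (M : List (Edge G))
      (m : 𝟙_ C ⟶ tensorList X (L ++ a :: b :: M)) :
      Evaluates π X g S (L ++ a :: b :: M) m →
      Evaluates π X g S (L ++ b :: a :: M) (m ≫ swapAt X a b M L)
  | node (S : Set V) (v : V) (hv : v ∉ S) (M : List (Edge G))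
      (m : 𝟙_ C ⟶ tensorList X (π.inc v ++ M)) :
      Evaluates π X g S (π.inc v ++ M) m →
      Evaluates π X g (insert v S) (π.out v ++ M)
        (m ≫ applyFirst X (π.inc v) (π.out v) M (g v))

/-- The morphism `m : 𝟙_ ⟶ 𝟙_` is the value of the labelled graph: it is obtained by evaluating
the whole diagram, each node having been used once and no wire being left.  By the coherence of
the graphical calculus of symmetric monoidal categories, `m` does not depend on the slicing. -/
def IsValue (π : Polarization G) (X : Edge G → C)
    (g : ∀ v, tensorList X (π.inc v) ⟶ tensorList X (π.out v)) (m : 𝟙_ C ⟶ 𝟙_ C) : Prop :=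
  Evaluates π X g Set.univ [] m

end Value

/-! ### Correlations -/

section Correlations

/-- A family of operations indexed by a finite set of outcomes whose sum is normalized. -/
def IsInstrument {C : Type u₁} [Category.{v₁} C] [MonoidalCategory C] [SymmetricCategory C]
    [OperationCategory C] {O : Type w₂} [Fintype O] {A B : C} (f : O → (A ⟶ B)) : Prop :=
  normalized (∑ o, f o)

/-- `P` is a `C`-correlation on the graph `G` with outcome sets `O v`: there are objects on the
edges and instruments on the nodes such that for each joint outcome `o` the value of the resulting
diagram is the number `P o`. -/
def IsCorrelation (C : Type u₁) [Category.{v₁} C] [MonoidalCategory C] [SymmetricCategory C]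
    [OperationCategory C] {V : Type w₁} {G : Digraph V} (π : Polarization G)
    {O : V → Type w₂} [∀ v, Fintype (O v)] (P : (∀ v, O v) → ℝ≥0) : Prop :=
  ∃ (X : Edge G → C) (f : ∀ v, O v → (tensorList X (π.inc v) ⟶ tensorList X (π.out v))),
    (∀ v, IsInstrument (f v)) ∧
    ∀ o : ∀ v, O v, IsValue π X (fun v => f v (o v)) (P o • 𝟙 (𝟙_ C))

end Correlations

end OperationCategory

/-! Push the whole model through `F`: relabel each edge by `F.obj (X e)` and each node by `F.map (f
v o)`. The image of a tensor product over a list of edges is only isomorphic to the tensor product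
of the images, so the node labels are conjugated by the comparison isomorphisms `mapTensorList`,
built from `ε` and `μ`.

These isomorphisms are natural for both kinds of slice (`mapTensorList_applyFirst`,
`mapTensorList_swapAt`). Hence they cancel between consecutive slices, and `Evaluates.map` follows
by induction on the slicing. On a closed diagram only `ε` and `η` remain; they cancel around a
scalar by linearity. Instruments stay instruments because `F` is linear and the comparison
isomorphisms are normalized. -/

namespace OperationCategory

open Functor.LaxMonoidal Functor.OplaxMonoidal

/-! ### Comparison isomorphisms for iterated tensor products -/

section MapTensorList

variable {C : Type u₁} [Category.{v₁} C] [MonoidalCategory C]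
  {D : Type u₂} [Category.{v₂} D] [MonoidalCategory D]

/-- A monoidal functor commutes with tensor products over lists. -/
def mapTensorList (F : C ⥤ D) [F.Monoidal] {E : Type w₁} (X : E → C) :
    ∀ L : List E, tensorList (fun e => F.obj (X e)) L ≅ F.obj (tensorList X L)
  | [] => Functor.Monoidal.εIso F
  | e :: L => whiskerLeftIso (F.obj (X e)) (mapTensorList F X L) ≪≫
      Functor.Monoidal.μIso F (X e) (tensorList X L)

variable (F : C ⥤ D) [F.Monoidal] {E : Type w₁} (X : E → C)

@[simp]
theorem mapTensorList_nil_inv : (mapTensorList F X []).inv = η F := rfl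

@[simp]
theorem mapTensorList_cons_hom (e : E) (L : List E) :
    (mapTensorList F X (e :: L)).hom =
      F.obj (X e) ◁ (mapTensorList F X L).hom ≫ μ F (X e) (tensorList X L) := rfl

/-- The comparison isomorphisms are compatible with concatenation of lists. -/
theorem mapTensorList_append (M L : List E) :
    (mapTensorList F X (L ++ M)).hom ≫ F.map (tensorListAppend X M L).hom =
      (tensorListAppend (fun e => F.obj (X e)) M L).hom ≫
        ((mapTensorList F X L).hom ⊗ₘ (mapTensorList F X M).hom) ≫
          μ F (tensorList X L) (tensorList X M) := by
  induction L with
  | nil =>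
    change (mapTensorList F X M).hom ≫ F.map (λ_ (tensorList X M)).inv =
      (λ_ _).inv ≫ (ε F ⊗ₘ (mapTensorList F X M).hom) ≫ μ F (𝟙_ C) (tensorList X M)
    -- Left unitality of `F`.
    rw [ε_tensorHom_comp_μ, MonoidalCategory.id_whiskerLeft]
    simp only [Category.assoc, Iso.inv_hom_id_assoc]
  | cons e L ih =>
    change (F.obj (X e) ◁ (mapTensorList F X (L ++ M)).hom ≫ μ F (X e) (tensorList X (L ++ M))) ≫
        F.map (X e ◁ (tensorListAppend X M L).hom ≫ (α_ _ _ _).inv) =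
      (F.obj (X e) ◁ (tensorListAppend _ M L).hom ≫ (α_ _ _ _).inv) ≫
        ((F.obj (X e) ◁ (mapTensorList F X L).hom ≫ μ F (X e) (tensorList X L)) ⊗ₘ
          (mapTensorList F X M).hom) ≫ μ F (X e ⊗ tensorList X L) (tensorList X M)
    -- The induction hypothesis, tensored with the new factor, is combined with the associativity
    -- axiom for `μ`.
    have h := congrArg (fun t => F.obj (X e) ◁ t) ih
    simp only [MonoidalCategory.whiskerLeft_comp] at h
    rw [F.map_comp, Category.assoc, ← μ_natural_right_assoc, reassoc_of% h,
      Functor.LaxMonoidal.associativity_inv]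
    simp [MonoidalCategory.tensorHom_def']

/-- The comparison isomorphisms are compatible with operations on the first factors. -/
theorem mapTensorList_applyFirst (L L' M : List E) (g : tensorList X L ⟶ tensorList X L') :
    (mapTensorList F X (L ++ M)).hom ≫ F.map (applyFirst X L L' M g) =
      applyFirst (fun e => F.obj (X e)) L L' M
          ((mapTensorList F X L).hom ≫ F.map g ≫ (mapTensorList F X L').inv) ≫
        (mapTensorList F X (L' ++ M)).hom := by
  -- Regrouping after the operation turns both sides into maps to the image of a binary tensor
  -- product, where naturality of `μ` and the interchange law suffice.
  rw [← cancel_mono (F.map (tensorListAppend X M L').hom), Category.assoc, Category.assoc,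
    mapTensorList_append]
  simp only [applyFirst, Category.assoc, ← Functor.map_comp, Iso.inv_hom_id, Category.comp_id,
    Iso.inv_hom_id_assoc]
  rw [Functor.map_comp, ← Category.assoc, mapTensorList_append]
  simp only [Category.assoc, MonoidalCategory.tensorHom_def', ← μ_natural_left,
    MonoidalCategory.comp_whiskerRight, MonoidalCategory.whisker_exchange_assoc,
    MonoidalCategory.inv_hom_whiskerRight_assoc]

end MapTensorList

/-! ### Transport of string diagrams -/

section MapEvaluates

variable {C : Type u₁} [Category.{v₁} C] [MonoidalCategory C] [SymmetricCategory C]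
  {D : Type u₂} [Category.{v₂} D] [MonoidalCategory D] [SymmetricCategory D]
  (F : C ⥤ D) [F.Braided]

/-- The comparison isomorphisms are compatible with crossings of neighbouring factors. -/
theorem mapTensorList_swapAt {E : Type w₁} (X : E → C) (a b : E) (M L : List E) :
    (mapTensorList F X (L ++ a :: b :: M)).hom ≫ F.map (swapAt X a b M L) =
      swapAt (fun e => F.obj (X e)) a b M L ≫ (mapTensorList F X (L ++ b :: a :: M)).hom := by
  induction L with
  | nil =>
    change (mapTensorList F X (a :: b :: M)).hom ≫ F.map (swapFirst X a b M) =
      swapFirst (fun e => F.obj (X e)) a b M ≫ (mapTensorList F X (b :: a :: M)).hom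
    -- The compatibility of `μ` with the symmetries, next to the remaining wires; everything else in
    -- this case is associativity and naturality.
    have hβ : μ F (X a) (X b) ▷ F.obj (tensorList X M) ≫
          F.map (β_ (X a) (X b)).hom ▷ F.obj (tensorList X M) =
        (β_ (F.obj (X a)) (F.obj (X b))).hom ▷ F.obj (tensorList X M) ≫
          μ F (X b) (X a) ▷ F.obj (tensorList X M) := by
      rw [← MonoidalCategory.comp_whiskerRight, Functor.LaxBraided.braided,
        MonoidalCategory.comp_whiskerRight]
    simp only [mapTensorList_cons_hom, swapFirst, MonoidalCategory.whiskerLeft_comp,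
      Functor.map_comp, Category.assoc]
    rw [Functor.LaxMonoidal.associativity_inv_assoc, ← μ_natural_left_assoc, reassoc_of% hβ,
      Functor.LaxMonoidal.associativity, ← MonoidalCategory.associator_naturality_right_assoc,
      MonoidalCategory.associator_inv_naturality_right_assoc,
      MonoidalCategory.whisker_exchange_assoc]
  | cons e L ih =>
    change (F.obj (X e) ◁ (mapTensorList F X (L ++ a :: b :: M)).hom ≫ μ F _ _) ≫
        F.map (X e ◁ swapAt X a b M L) =
      F.obj (X e) ◁ swapAt _ a b M L ≫
        F.obj (X e) ◁ (mapTensorList F X (L ++ b :: a :: M)).hom ≫ μ F _ _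
    rw [← MonoidalCategory.whiskerLeft_comp_assoc, ← ih]
    simp

/-- A braided functor sends an evaluation of a labelled diagram to an evaluation of its image. -/
theorem Evaluates.map {V : Type w₁} {G : Digraph V} {π : Polarization G} {X : Edge G → C}
    {g : ∀ v, tensorList X (π.inc v) ⟶ tensorList X (π.out v)} {S : Set V} {L : List (Edge G)}
    {m : 𝟙_ C ⟶ tensorList X L} (h : Evaluates π X g S L m) :
    Evaluates π (fun e => F.obj (X e))
      (fun v => (mapTensorList F X (π.inc v)).hom ≫ F.map (g v) ≫
        (mapTensorList F X (π.out v)).inv) S L (ε F ≫ F.map m ≫ (mapTensorList F X L).inv) := by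
  induction h with
  | start =>
    have h : ε F ≫ F.map (𝟙 (𝟙_ C)) ≫ (mapTensorList F X []).inv = 𝟙 (𝟙_ D) := by simp
    rw [h]
    exact .start
  | swap S L a b M m _ ih =>
    convert Evaluates.swap S L a b M _ ih using 1
    have h := mapTensorList_swapAt F X a b M L
    -- The square is solved for `F.map` of the slice followed by the inverse comparison, the form in
    -- which it ends the transported morphism.
    rw [← Iso.eq_inv_comp, ← Category.assoc, ← Iso.comp_inv_eq] at h
    simp only [Functor.map_comp, Category.assoc, ← h]
  | node S v hv M m _ ih =>
    convert Evaluates.node S v hv M _ ih using 1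
    have h := mapTensorList_applyFirst F X (π.inc v) (π.out v) M (g v)
    rw [← Iso.eq_inv_comp, ← Category.assoc, ← Iso.comp_inv_eq] at h
    simp only [Functor.map_comp, Category.assoc, ← h]

end MapEvaluates

/-! ### Normalization and linearity -/

section NormalizedMap

variable {C : Type u₁} [Category.{v₁} C] [MonoidalCategory C] [SymmetricCategory C]
  [OperationCategory C]
  {D : Type u₂} [Category.{v₂} D] [MonoidalCategory D] [SymmetricCategory D]
  [OperationCategory D]

theorem normalized_comp {X Y Z : C} {f : X ⟶ Y} {g : Y ⟶ Z} (hf : normalized f)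
    (hg : normalized g) : normalized (f ≫ g) :=
  haveI := normalized_monoidal (C := C)
  MorphismProperty.comp_mem _ f g hf hg

theorem normalized_whiskerLeft (X : C) {Y Z : C} {f : Y ⟶ Z} (hf : normalized f) :
    normalized (X ◁ f) :=
  haveI := normalized_monoidal (C := C)
  MorphismProperty.whiskerLeft_mem _ X f hf

variable {F : C ⥤ D}

theorem PreservesNormalized.mapTensorList_hom [F.Monoidal] (hF : PreservesNormalized F)
    {E : Type w₁} (X : E → C) : ∀ L : List E, normalized (mapTensorList F X L).hom
  | [] => hF.ε_mem
  | _ :: L => normalized_comp (normalized_whiskerLeft _ (hF.mapTensorList_hom X L)) (hF.μ_mem _ _)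

theorem PreservesNormalized.mapTensorList_inv [F.Monoidal] (hF : PreservesNormalized F)
    {E : Type w₁} (X : E → C) : ∀ L : List E, normalized (mapTensorList F X L).inv
  | [] => hF.η_mem
  | _ :: L => normalized_comp (hF.δ_mem _ _) (normalized_whiskerLeft _ (hF.mapTensorList_inv X L))

/-- Preservation of zero is not an axiom of `IsLinearFunctor`; it comes from the scalar `0`. It is
needed for sums over an empty outcome set. -/
theorem IsLinearFunctor.map_zero (hF : IsLinearFunctor F) (X Y : C) :
    F.map (0 : X ⟶ Y) = 0 := by
  simpa using hF.map_smul (0 : ℝ≥0) (0 : X ⟶ Y)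

theorem IsLinearFunctor.map_sum (hF : IsLinearFunctor F) {O : Type w₂} [Fintype O] {X Y : C}
    (f : O → (X ⟶ Y)) : F.map (∑ o, f o) = ∑ o, F.map (f o) :=
  _root_.map_sum (⟨⟨F.map, hF.map_zero X Y⟩, hF.map_add⟩ : (X ⟶ Y) →+ _) f _

theorem comp_sum {O : Type w₂} [Fintype O] {X Y Z : C} (h : X ⟶ Y) (f : O → (Y ⟶ Z)) :
    h ≫ ∑ o, f o = ∑ o, h ≫ f o :=
  map_sum (⟨⟨fun k => h ≫ k, by simpa using comp_smul (0 : ℝ≥0) h (0 : Y ⟶ Z)⟩,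
    comp_add h⟩ : (Y ⟶ Z) →+ _) f _

theorem sum_comp {O : Type w₂} [Fintype O] {X Y Z : C} (f : O → (X ⟶ Y)) (h : Y ⟶ Z) :
    (∑ o, f o) ≫ h = ∑ o, f o ≫ h :=
  map_sum (⟨⟨fun k => k ≫ h, by simpa using smul_comp (0 : ℝ≥0) (0 : X ⟶ Y) h⟩,
    fun k l => add_comp k l h⟩ : (X ⟶ Y) →+ _) f _

/-- An instrument is carried to an instrument by a linear functor, also after composition with
normalized operations. -/
theorem IsInstrument.map (hlin : IsLinearFunctor F) (hnorm : ∀ {X Y : C} (f : X ⟶ Y),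
    normalized f → normalized (F.map f)) {O : Type w₂} [Fintype O] {A B : C} {f : O → (A ⟶ B)}
    (hf : IsInstrument f) {A' B' : D} {h : A' ⟶ F.obj A} {k : F.obj B ⟶ B'}
    (hh : normalized h) (hk : normalized k) : IsInstrument fun o => h ≫ F.map (f o) ≫ k := by
  have e : ∑ o, h ≫ F.map (f o) ≫ k = h ≫ F.map (∑ o, f o) ≫ k := by
    rw [hlin.map_sum, sum_comp, comp_sum]
  rw [IsInstrument, e]
  exact normalized_comp hh (normalized_comp (hnorm _ hf) hk)

end NormalizedMap

end OperationCategory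

theorem mainTheorem9
    {C : Type u₁} [Category.{v₁} C] [MonoidalCategory C] [SymmetricCategory C]
    [OperationCategory C]
    {D : Type u₂} [Category.{v₂} D] [MonoidalCategory D] [SymmetricCategory D]
    [OperationCategory D]
    (F : C ⥤ D) [F.Braided]
    (hlin : OperationCategory.IsLinearFunctor F)
    (hnorm : OperationCategory.PreservesNormalized F)
    {V : Type w₁} [Finite V] (G : Digraph V) (hG : OperationCategory.IsAcyclic G)
    (π : OperationCategory.Polarization G)
    (O : V → Type w₂) [∀ v, Fintype (O v)] (P : (∀ v, O v) → ℝ≥0)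
    (hP : OperationCategory.IsCorrelation C π P) :
    OperationCategory.IsCorrelation D π P := by
  obtain ⟨X, f, hf, hv⟩ := hP
  -- These node labels are exactly those produced by `Evaluates.map`.
  refine ⟨fun e => F.obj (X e), fun v o => (OperationCategory.mapTensorList F X (π.inc v)).hom ≫
    F.map (f v o) ≫ (OperationCategory.mapTensorList F X (π.out v)).inv, fun v => ?_, fun o => ?_⟩
  · exact (hf v).map hlin hnorm.map_mem (hnorm.mapTensorList_hom X _) (hnorm.mapTensorList_inv X _)
  -- The comparison for the empty list has inverse `η F`, so the scalar comes out and `ε F ≫ η F` is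
  -- the identity.
  · have e : Functor.LaxMonoidal.ε F ≫ F.map (P o • 𝟙 (𝟙_ C)) ≫
        (OperationCategory.mapTensorList F X []).inv = P o • 𝟙 (𝟙_ D) := by
      rw [hlin.map_smul, OperationCategory.smul_comp, OperationCategory.comp_smul]
      simp
    rw [← e]
    exact (hv o).map F
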